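/- Let $\theta\in(0,1]$, let $\lambda_t\ge 0$ ($t\ge0$) be a rate function with $\Lambda_t=\int_0^t\lambda_u\,du<\infty$ for all $t\ge 0$, and let $a_t$ ($t\ge 0$) be measurable with $0\le a_t\le 1+1/\theta$. A theta-positive branching process $\{Z_t\}_{t\ge0}$ with parameters $(\theta,\{\lambda_t\},\{a_t\})$ is a (right-continuous) time inhomogeneous Markov branching process with $Z_0=1$, in which the individuals live and reproduce independently of each other, an individual alive at time $t$ dies at rate $\lambda_t$, and an individual dying at time $t$ is instantaneously replaced by a random number of offspring with probability generating function $$h_t(s)=1-a_t(1-s)+\frac{a_t}{1+\theta}(1-s)^{1+\theta}.$$ Put $\mu_t=\mathrm E(Z_t)$. The process is called asymptotically degenerate if $q=\lim_{t\to\infty}\mathrm P(Z_t=0)<1$ and $\liminf_{t\to\infty}\mu_t<\infty$. Suppose that $\Lambda=\lim_{t\to\infty}\Lambda_t<\infty$ and that $a_t=0$ for all $t\ge 0$. Then the process is asymptotically degenerate, $\mu_t\to\mu=e^{-\Lambda}$ as $t\to\infty$, and $Z_t$ converges almost surely, as $t\to\infty$, to a random variable $Z_\infty$ that has the Bernoulli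 distribution $\mathrm P(Z_\infty=1)=\mu=1-\mathrm P(Z_\infty=0)$, that is, $$\mathrm E(s^{Z_\infty})=1-\mu+\mu s,\qquad 0\le s\le 1.$$ -/

import Mathlib

open MeasureTheory ProbabilityTheory Filter Topology
open scoped ENNReal NNReal

noncomputable section

/-- The theta-positive offspring distribution with branching parameter `θ` and mean `a`:
`p(0) = 1 - θ a / (1 + θ)`, `p(1) = 0` and
`p(n) = θ (1 - θ) (2 - θ) ⋯ (n - 2 - θ) a / n!` for `n ≥ 2`. Its probability generating function
is `1 - a (1 - s) + a (1 - s) ^ (1 + θ) / (1 + θ)`. -/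
def thetaOffspring (θ a : ℝ) : ℕ → ℝ
  | 0 => 1 - θ / (1 + θ) * a
  | 1 => 0
  | n + 2 => θ * (∏ j ∈ Finset.range n, ((j : ℝ) + 1 - θ)) * a / ((n + 2).factorial : ℝ)

/-- The time dependent generator of the population size of a Markov branching process in varying
environment: at time `t`, each of the `i` individuals alive dies, independently of the others, at
rate `lam t` and is replaced by `k` offspring with probability `p t k`, so that the population
size jumps from `i` to `i - 1 + k`. -/
def branchingGenerator (lam : ℝ → ℝ) (p : ℝ → ℕ → ℝ) (f : ℕ → ℝ) (t : ℝ) (i : ℕ) : ℝ :=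
  (i : ℝ) * lam t * ∑' k : ℕ, p t k * (f (i + k - 1) - f i)

variable {Ω : Type*} [MeasurableSpace Ω]

/-- `Z` is (a right-continuous version of) the time inhomogeneous Markov branching process started
from one individual, with death rates `lam t` and offspring laws `p t`. The infinitesimal
description `P(Z (t + δ) = i - 1 + k ∣ past up to t, Z t = i) = i * lam t * p t k * δ + o(δ)`
is written in integrated form, as the martingale problem for the generator, which
makes sense for every locally integrable death rate. -/
structure IsBranchingProcess (lam : ℝ → ℝ) (p : ℝ → ℕ → ℝ) (P : Measure Ω)
    (Z : ℝ≥0 → Ω → ℕ) : Prop where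
  measurable : ∀ t, Measurable (Z t)
  init : ∀ᵐ ω ∂P, Z 0 ω = 1
  rightContinuous : ∀ ω t, ContinuousWithinAt (fun u => Z u ω) (Set.Ici t) t
  martingale : ∀ f : ℕ → ℝ, f.support.Finite →
    Martingale
      (fun (t : ℝ≥0) ω => f (Z t ω) -
        ∫ u in (0 : ℝ)..t, branchingGenerator lam p f u (Z u.toNNReal ω))
      (Filtration.natural Z fun t => (measurable t).stronglyMeasurable) P

/-- Theta-positive branching process with branching parameter `θ` in the varying environment
`(lam, a)`. Only the values of `lam` and `a` at times `t ≥ 0` matter. -/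
structure IsThetaPositiveProcess (θ : ℝ) (lam a : ℝ → ℝ) (P : Measure Ω)
    (Z : ℝ≥0 → Ω → ℕ) : Prop where
  theta_pos : 0 < θ
  theta_le_one : θ ≤ 1
  rate_nonneg : ∀ t, 0 ≤ t → 0 ≤ lam t
  rate_integrable : ∀ t, 0 ≤ t → IntervalIntegrable lam volume 0 t
  mean_measurable : Measurable a
  mean_nonneg : ∀ t, 0 ≤ t → 0 ≤ a t
  mean_le : ∀ t, 0 ≤ t → a t ≤ 1 + 1 / θ
  isBranchingProcess : IsBranchingProcess lam (fun t => thetaOffspring θ (a t)) P Z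

/-- The cumulative hazard function `Λ_t = ∫₀ᵗ λ_u du`. -/
def cumulativeHazard (lam : ℝ → ℝ) (t : ℝ≥0) : ℝ := ∫ u in (0 : ℝ)..t, lam u

/-- The mean population size `μ_t = E(Z_t)`, a priori in `[0, ∞]`. -/
def meanSize (P : Measure Ω) (Z : ℝ≥0 → Ω → ℕ) (t : ℝ≥0) : ℝ≥0∞ := ∫⁻ ω, (Z t ω : ℝ≥0∞) ∂P

/-- The process is asymptotically degenerate: the extinction probability `q = lim P(Z_t = 0)`
is smaller than `1`, and `liminf μ_t < ∞`. -/
def IsAsymptoticallyDegenerate (P : Measure Ω) (Z : ℝ≥0 → Ω → ℕ) : Prop :=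
  (∃ q : ℝ, Tendsto (fun t => P.real {ω | Z t ω = 0}) atTop (𝓝 q) ∧ q < 1) ∧
    liminf (meanSize P Z) atTop < ∞

end

/-! Without offspring the generator is `lam t` times the pure death operator, so everything follows
from Dynkin's formula applied to three indicators. The indicator of `{0, 1}` shows that the process
never exceeds one individual, and that of `{0}`, localised to the event of extinction by time `s`,
shows that zero is absorbing. The indicator of `{1}` gives `m = 1 - ∫ lam * m` for the survival
probability `m`, whence `m t = exp (-Λ_t)`. Paths are therefore almost surely nonincreasing with
values in `{0, 1}`; they converge, and the limit is the indicator of eternal survival, of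
probability `exp (-L)`. -/

/-! ### Linear integral equation with an integrable rate -/

/-- The composition of a Lipschitz function with an absolutely continuous one is absolutely
continuous. -/
theorem LipschitzOnWith.comp_absolutelyContinuousOnInterval {f φ : ℝ → ℝ} {K : ℝ≥0} {S : Set ℝ}
    {b c : ℝ} (hφ : LipschitzOnWith K φ S) (hf : AbsolutelyContinuousOnInterval f b c)
    (hfS : Set.MapsTo f (Set.uIcc b c) S) :
    AbsolutelyContinuousOnInterval (fun x => φ (f x)) b c := by
  refine squeeze_zero' (Eventually.of_forall fun E => Finset.sum_nonneg fun i _ => dist_nonneg) ?_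
    (by simpa using Tendsto.const_mul (K : ℝ) hf)
  rw [eventually_inf_principal]
  refine Eventually.of_forall fun E hE => ?_
  rw [Finset.mul_sum]
  exact Finset.sum_le_sum fun i hi =>
    hφ.dist_le_mul _ (hfS (hE.1 i hi).1) _ (hfS (hE.1 i hi).2)

/-- The integral equation `m t = 1 - ∫₀ᵗ lam m` has the solution `exp (-∫₀ᵗ lam)` only. -/
theorem eq_exp_neg_integral_of_integral_equation {lam m : ℝ → ℝ} {T : ℝ} (hT : 0 ≤ T)
    (hlam : IntervalIntegrable lam volume 0 T)
    (hlm : IntervalIntegrable (fun u => lam u * m u) volume 0 T)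
    (hm : ∀ t ∈ Set.Icc 0 T, m t = 1 - ∫ u in (0 : ℝ)..t, lam u * m u) :
    m T = Real.exp (-∫ u in (0 : ℝ)..T, lam u) := by
  have h0 : (0 : ℝ) ∈ Set.uIcc 0 T := Set.left_mem_uIcc
  have hΛ := hlam.absolutelyContinuousOnInterval_intervalIntegral h0
  have hI := hlm.absolutelyContinuousOnInterval_intervalIntegral h0
  obtain ⟨C, hC⟩ := hΛ.exists_bound
  -- `exp` is Lipschitz only on bounded sets; the bound `C` on the cumulative rate provides one.
  obtain ⟨K, hK⟩ := (Real.contDiff_exp (n := 1)).contDiffOn.exists_lipschitzOnWith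
    (s := Set.Icc (-C) C) (by decide) (convex_Icc _ _) isCompact_Icc
  have hexp := hK.comp_absolutelyContinuousOnInterval hΛ fun x hx => abs_le.mp (hC x hx)
  have hone : AbsolutelyContinuousOnInterval (fun _ : ℝ => (1 : ℝ)) 0 T :=
    contDiff_const.contDiffOn.absolutelyContinuousOnInterval
  -- As `lam` is merely integrable, derivatives exist only almost everywhere; absolute continuity
  -- still makes `(1 - ∫ lam * m) * exp (∫ lam)` constant.
  obtain ⟨c, hc⟩ := ((hone.sub hI).mul hexp).const_of_ae_hasDerivAt_zero (by
    filter_upwards [hlam.ae_hasDerivAt_integral, hlm.ae_hasDerivAt_integral] with x h1 h2 hx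
    have h1 := (h1 hx 0 h0).exp
    have h2 := (h2 hx 0 h0).const_sub 1
    refine (h2.mul h1).congr_deriv ?_
    rw [hm x (by rwa [Set.uIcc_of_le hT] at hx)]
    ring)
  have e0 := hc 0 h0
  have eT := hc T Set.right_mem_uIcc
  simp only [Pi.mul_apply, Pi.sub_apply, intervalIntegral.integral_same, sub_zero, Real.exp_zero,
    mul_one] at e0 eT
  rw [← hm T ⟨hT, le_rfl⟩, ← e0] at eT
  rw [Real.exp_neg]
  exact eq_inv_of_mul_eq_one_left eT

/-! ### Joint measurability -/

/-- A right-continuous process is jointly measurable. -/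
theorem measurable_uncurry_of_continuousWithinAt_Ici {Ω : Type*} [MeasurableSpace Ω]
    {Z : ℝ≥0 → Ω → ℕ} (hm : ∀ t, Measurable (Z t))
    (hc : ∀ ω t, ContinuousWithinAt (fun u => Z u ω) (Set.Ici t) t) :
    Measurable (Function.uncurry Z) := by
  -- Time is rounded to a grid point strictly above it, so that right-continuity yields convergence.
  have hdisc : ∀ n : ℕ, Measurable fun p : ℝ≥0 × Ω =>
      Z (((⌊(n + 1 : ℝ≥0) * p.1⌋₊ : ℝ≥0) + 1) / (n + 1)) p.2 := fun n => by
    have hg : ∀ g : ℕ → ℝ≥0, Measurable fun q : ℕ × Ω => Z (g q.1) q.2 := fun g =>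
      measurable_from_prod_countable_right fun k => hm (g k)
    have hfloor : Measurable fun p : ℝ≥0 × Ω => ⌊(n + 1 : ℝ≥0) * p.1⌋₊ := by
      apply Nat.measurable_floor.comp
      fun_prop
    have h := (hg fun k => ((k : ℝ≥0) + 1) / (n + 1)).comp (hfloor.prodMk measurable_snd)
    exact h
  refine measurable_of_tendsto_metrizable hdisc (tendsto_pi_nhds.2 fun p => ?_)
  refine (hc p.2 p.1).tendsto.comp (tendsto_nhdsWithin_iff.2 ⟨?_, Eventually.of_forall fun n => ?_⟩)
  · have hlim : Tendsto (fun n : ℕ => p.1 + 1 / ((n : ℝ≥0) + 1)) atTop (𝓝 p.1) := by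
      simpa using tendsto_const_nhds.add (tendsto_one_div_add_atTop_nhds_zero_nat (𝕜 := ℝ≥0))
    refine tendsto_of_tendsto_of_tendsto_of_le_of_le tendsto_const_nhds hlim (fun n => ?_)
      fun n => ?_
    · rw [le_div_iff₀ (by positivity), mul_comm]
      exact (Nat.lt_floor_add_one _).le
    · rw [div_le_iff₀ (by positivity), add_mul p.1, one_div, inv_mul_cancel₀ (by positivity),
        mul_comm p.1]
      gcongr
      exact Nat.floor_le (by positivity)
  · simp only [Set.mem_Ici]
    rw [le_div_iff₀ (by positivity), mul_comm]
    exact (Nat.lt_floor_add_one _).le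

/-! ### The generator without offspring -/

theorem thetaOffspring_zero_right (θ : ℝ) (k : ℕ) :
    thetaOffspring θ 0 k = if k = 0 then 1 else 0 := by
  match k with
  | 0 => simp [thetaOffspring]
  | 1 => simp [thetaOffspring]
  | n + 2 => simp [thetaOffspring]

/-- The generator of the linear pure death process with unit death rate. -/
def deathOperator (f : ℕ → ℝ) (i : ℕ) : ℝ := i * (f (i - 1) - f i)

theorem branchingGenerator_of_mean_eq_zero (θ : ℝ) (lam a : ℝ → ℝ) (f : ℕ → ℝ) (t : ℝ) (i : ℕ)
    (ha : a t = 0) :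
    branchingGenerator lam (fun t => thetaOffspring θ (a t)) f t i
      = lam t * deathOperator f i := by
  simp only [branchingGenerator, ha, thetaOffspring_zero_right]
  rw [tsum_eq_single 0 (by simp +contextual)]
  simp only [if_pos, add_zero, one_mul, deathOperator]
  ring

theorem exists_abs_le_of_finite_support {f : ℕ → ℝ} (hf : f.support.Finite) :
    ∃ C, ∀ i, |f i| ≤ C := by
  obtain ⟨C, hC⟩ := (hf.image fun i => |f i|).bddAbove
  refine ⟨max C 0, fun i => ?_⟩
  by_cases h : f i = 0
  · simp [h]
  · exact (hC ⟨i, h, rfl⟩).trans (le_max_left _ _)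

/-- Only `f i` and `f (i - 1)` enter, and the factor `i` kills the truncated case `i = 0`. Hence the
generator term is bounded despite that factor, which is what Fubini needs below. -/
theorem finite_support_deathOperator {f : ℕ → ℝ} (hf : f.support.Finite) :
    (deathOperator f).support.Finite := by
  refine (hf.union (hf.image (· + 1))).subset fun i hi => ?_
  by_contra h
  simp only [Set.mem_union, Function.mem_support, Set.mem_image, not_or, not_not, not_exists,
    not_and] at h
  rcases i with _ | i
  · simp [deathOperator] at hi
  · have : f i = 0 := by
      by_contra h'
      exact h.2 i h' rfl
    simp [deathOperator, this, h.1] at hi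

/-! ### Dynkin's formula and its consequences -/

section PureDeath

variable {Ω : Type*} [MeasurableSpace Ω] {P : Measure Ω} [IsProbabilityMeasure P] {θ : ℝ}
  {lam a : ℝ → ℝ} {Z : ℝ≥0 → Ω → ℕ}

/-- Dynkin's formula for the theta-positive process without offspring. -/
theorem IsThetaPositiveProcess.setIntegral_sub_setIntegral
    (hZ : IsThetaPositiveProcess θ lam a P Z) (ha : ∀ t, 0 ≤ t → a t = 0) {f : ℕ → ℝ}
    (hf : f.support.Finite) {s t : ℝ≥0} (hst : s ≤ t) {A : Set Ω}
    (hA : MeasurableSet[Filtration.natural Z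
      (fun t => (hZ.isBranchingProcess.measurable t).stronglyMeasurable) s] A) :
    ∫ ω in A, f (Z t ω) ∂P - ∫ ω in A, f (Z s ω) ∂P
      = ∫ u in (s : ℝ)..t, lam u * ∫ ω in A, deathOperator f (Z u.toNNReal ω) ∂P := by
  have hB := hZ.isBranchingProcess
  have hjoint : Measurable fun p : ℝ × Ω => Z p.1.toNNReal p.2 :=
    (measurable_uncurry_of_continuousWithinAt_Ici hB.measurable hB.rightContinuous).comp
      (measurable_real_toNNReal.prodMap measurable_id)
  obtain ⟨C, hC⟩ := exists_abs_le_of_finite_support hf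
  obtain ⟨D, hD⟩ := exists_abs_le_of_finite_support (finite_support_deathOperator hf)
  have hlam : ∀ r : ℝ≥0, IntervalIntegrable lam volume 0 r := fun r => hZ.rate_integrable r r.2
  have hlamst : IntervalIntegrable lam volume s t := (hlam s).symm.trans (hlam t)
  have hfint : ∀ r, Integrable (fun ω => f (Z r ω)) P := fun r =>
    .of_bound ((measurable_of_countable f).comp (hB.measurable r)).aestronglyMeasurable C
      (ae_of_all _ fun ω => hC _)
  have hpath : ∀ (r : ℝ≥0) ω, IntervalIntegrable
      (fun u => lam u * deathOperator f (Z u.toNNReal ω)) volume 0 r := fun r ω =>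
    intervalIntegrable_iff.2 <| Integrable.mul_bdd (c := D) (intervalIntegrable_iff.1 (hlam r))
      ((measurable_of_countable (deathOperator f)).comp
        (hjoint.comp measurable_prodMk_right)).aestronglyMeasurable (ae_of_all _ fun u => hD _)
  have hgen : ∀ (r : ℝ≥0) ω,
      ∫ u in (0 : ℝ)..r, branchingGenerator lam (fun t => thetaOffspring θ (a t)) f u
        (Z u.toNNReal ω) = ∫ u in (0 : ℝ)..r, lam u * deathOperator f (Z u.toNNReal ω) :=
    fun r ω => intervalIntegral.integral_congr fun u hu => by
      rw [Set.uIcc_of_le r.coe_nonneg] at hu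
      exact branchingGenerator_of_mean_eq_zero _ _ _ _ _ _ (ha u hu.1)
  have hmart := hB.martingale f hf
  simp only [hgen] at hmart
  have hMint := fun r => (hmart.integrable r).integrableOn (s := A)
  have hIint : ∀ r : ℝ≥0, IntegrableOn
      (fun ω => ∫ u in (0 : ℝ)..r, lam u * deathOperator f (Z u.toNNReal ω)) A P := fun r =>
    (((hfint r).integrableOn (s := A)).sub (hMint r)).congr (ae_of_all _ fun ω => by simp)
  have key := hmart.setIntegral_eq hst hA
  rw [integral_sub (hfint s).integrableOn (hIint s),
    integral_sub (hfint t).integrableOn (hIint t)] at key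
  have hswap : Integrable (Function.uncurry fun u ω => lam u * deathOperator f (Z u.toNNReal ω))
      ((volume.restrict (Set.uIoc (s : ℝ) t)).prod (P.restrict A)) := by
    refine Integrable.mul_bdd (c := D) ?_ ((measurable_of_countable (deathOperator f)).comp
      hjoint).aestronglyMeasurable (ae_of_all _ fun u => hD _)
    exact Integrable.comp_fst (intervalIntegrable_iff.1 hlamst) _
  have h := intervalIntegral_integral_swap hswap
  simp only [integral_const_mul] at h
  rw [h]
  have hdiff : ∀ ω, ∫ u in (s : ℝ)..t, lam u * deathOperator f (Z u.toNNReal ω)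
      = (∫ u in (0 : ℝ)..t, lam u * deathOperator f (Z u.toNNReal ω))
        - ∫ u in (0 : ℝ)..s, lam u * deathOperator f (Z u.toNNReal ω) := fun ω =>
    (intervalIntegral.integral_interval_sub_left (hpath t ω) (hpath s ω)).symm
  simp only [hdiff]
  rw [integral_sub (hIint t) (hIint s)]
  linarith

theorem integral_indicator_one_comp (Q : Measure Ω) {X : Ω → ℕ} (hX : Measurable X) (S : Set ℕ) :
    ∫ ω, S.indicator 1 (X ω) ∂Q = Q.real (X ⁻¹' S) :=
  integral_indicator_one (hX (MeasurableSet.of_discrete (s := S)))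

/-- The theta-positive process without offspring has at most one individual. -/
theorem IsThetaPositiveProcess.ae_le_one (hZ : IsThetaPositiveProcess θ lam a P Z)
    (ha : ∀ t, 0 ≤ t → a t = 0) (t : ℝ≥0) : ∀ᵐ ω ∂P, Z t ω ≤ 1 := by
  have hm := hZ.isBranchingProcess.measurable
  have h := hZ.setIntegral_sub_setIntegral ha (f := (Set.Iic 1).indicator 1)
    ((Set.finite_Iic 1).subset Set.support_indicator_subset) (zero_le (a := t)) MeasurableSet.univ
  simp only [setIntegral_univ] at h
  rw [integral_indicator_one_comp P (hm t), integral_indicator_one_comp P (hm 0)] at h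
  -- A death never leads out of `{0, 1}`, so the generator term is nonnegative and the initial
  -- probability `1` cannot drop.
  have hpos : 0 ≤ ∫ u in ((0 : ℝ≥0) : ℝ)..t,
      lam u * ∫ ω, deathOperator ((Set.Iic 1).indicator 1) (Z u.toNNReal ω) ∂P := by
    refine intervalIntegral.integral_nonneg t.coe_nonneg fun u hu => ?_
    refine mul_nonneg (hZ.rate_nonneg u hu.1) (integral_nonneg fun ω => ?_)
    refine mul_nonneg (Nat.cast_nonneg _) (sub_nonneg.2 ?_)
    generalize Z u.toNNReal ω = i
    by_cases hi : i ≤ 1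
    · have hi' : i - 1 ≤ 1 := by omega
      rw [Set.indicator_of_mem (Set.mem_Iic.2 hi), Set.indicator_of_mem (Set.mem_Iic.2 hi')]
      exact le_rfl
    · simp only [Set.indicator, Set.mem_Iic, hi, if_false]
      split_ifs <;> simp
  have h0 : P.real (Z 0 ⁻¹' Set.Iic 1) = 1 := by
    rw [measureReal_def, (prob_compl_eq_zero_iff (hm 0 MeasurableSet.of_discrete)).1]
    · simp
    · exact hZ.isBranchingProcess.init.mono fun ω h => h.le
  have h1 : P.real (Z t ⁻¹' Set.Iic 1) = 1 := le_antisymm measureReal_le_one (by linarith)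
  have h2 : P (Z t ⁻¹' Set.Iic 1) = 1 := by
    rwa [measureReal_def, ENNReal.toReal_eq_one_iff] at h1
  exact (prob_compl_eq_zero_iff (hm t MeasurableSet.of_discrete)).2 h2

/-- Extinction is permanent. -/
theorem IsThetaPositiveProcess.ae_eq_zero_of_eq_zero (hZ : IsThetaPositiveProcess θ lam a P Z)
    (ha : ∀ t, 0 ≤ t → a t = 0) {s t : ℝ≥0} (hst : s ≤ t) :
    ∀ᵐ ω ∂P, Z s ω = 0 → Z t ω = 0 := by
  have hm := hZ.isBranchingProcess.measurable
  have h := hZ.setIntegral_sub_setIntegral ha (f := ({0} : Set ℕ).indicator 1)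
    ((Set.finite_singleton 0).subset Set.support_indicator_subset) hst (A := Z s ⁻¹' {0})
    ((Filtration.stronglyAdapted_natural _ s).measurable MeasurableSet.of_discrete)
  rw [integral_indicator_one_comp _ (hm t), integral_indicator_one_comp _ (hm s)] at h
  have hpos : 0 ≤ ∫ u in (s : ℝ)..t, lam u * ∫ ω in Z s ⁻¹' {0},
      deathOperator (({0} : Set ℕ).indicator 1) (Z u.toNNReal ω) ∂P := by
    refine intervalIntegral.integral_nonneg (by exact_mod_cast hst) fun u hu => ?_
    refine mul_nonneg (hZ.rate_nonneg u (s.coe_nonneg.trans hu.1)) (integral_nonneg fun ω => ?_)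
    simp only [deathOperator, Pi.zero_apply]
    rcases Z u.toNNReal ω with _ | i
    · simp
    · refine mul_nonneg (Nat.cast_nonneg _) (sub_nonneg.2 ?_)
      simp only [Set.indicator, Set.mem_singleton_iff, Nat.succ_ne_zero, if_false]
      split_ifs <;> simp
  rw [measureReal_restrict_apply (hm t MeasurableSet.of_discrete),
    measureReal_restrict_apply (hm s MeasurableSet.of_discrete), Set.inter_self, Set.inter_comm]
    at h
  have hd := measureReal_inter_add_sdiff (μ := P) (s := Z s ⁻¹' {0})
    (hm t (MeasurableSet.of_discrete (s := {0})))
  have hz : P.real (Z s ⁻¹' {0} \ Z t ⁻¹' {0}) = 0 :=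
    le_antisymm (by linarith) measureReal_nonneg
  rw [measureReal_eq_zero_iff] at hz
  refine measure_mono_null (fun ω hω => ?_) hz
  simpa using hω

/-- The survival probability of the theta-positive process without offspring. -/
theorem IsThetaPositiveProcess.measureReal_eq_one (hZ : IsThetaPositiveProcess θ lam a P Z)
    (ha : ∀ t, 0 ≤ t → a t = 0) (t : ℝ≥0) :
    P.real (Z t ⁻¹' {1}) = Real.exp (-cumulativeHazard lam t) := by
  have hm := hZ.isBranchingProcess.measurable
  have hjoint : Measurable fun p : ℝ × Ω => Z p.1.toNNReal p.2 :=
    (measurable_uncurry_of_continuousWithinAt_Ici hm hZ.isBranchingProcess.rightContinuous).comp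
      (measurable_real_toNNReal.prodMap measurable_id)
  have hmeas : Measurable fun u : ℝ => P.real (Z u.toNNReal ⁻¹' {1}) :=
    (measurable_measure_prodMk_left (ν := P)
      (hjoint (MeasurableSet.of_discrete (s := {1})))).ennreal_toReal
  have hlam := hZ.rate_integrable t t.coe_nonneg
  have hlm : IntervalIntegrable (fun u => lam u * P.real (Z u.toNNReal ⁻¹' {1})) volume 0 t :=
    intervalIntegrable_iff.2 <| Integrable.mul_bdd (c := 1) (intervalIntegrable_iff.1 hlam)
      hmeas.aestronglyMeasurable (ae_of_all _ fun u => by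
        rw [Real.norm_of_nonneg measureReal_nonneg]
        exact measureReal_le_one)
  have key := eq_exp_neg_integral_of_integral_equation
    (m := fun u => P.real (Z u.toNNReal ⁻¹' {1})) t.coe_nonneg hlam hlm fun r hr => ?_
  · simpa [cumulativeHazard] using key
  lift r to ℝ≥0 using hr.1
  have h := hZ.setIntegral_sub_setIntegral ha (f := ({1} : Set ℕ).indicator 1)
    ((Set.finite_singleton 1).subset Set.support_indicator_subset) (zero_le (a := r)) MeasurableSet.univ
  simp only [setIntegral_univ] at h
  rw [integral_indicator_one_comp P (hm r), integral_indicator_one_comp P (hm 0)] at h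
  have h0 : P.real (Z 0 ⁻¹' {1}) = 1 := by
    rw [measureReal_def, (prob_compl_eq_zero_iff (hm 0 MeasurableSet.of_discrete)).1]
    · simp
    · exact hZ.isBranchingProcess.init
  -- State `2` would contribute `+2`; it is excluded by `ae_le_one`.
  have hg : ∀ u : ℝ, ∫ ω, deathOperator (({1} : Set ℕ).indicator 1) (Z u.toNNReal ω) ∂P
      = -P.real (Z u.toNNReal ⁻¹' {1}) := fun u => by
    rw [← integral_indicator_one_comp P (hm _), ← integral_neg]
    refine integral_congr_ae ?_
    filter_upwards [hZ.ae_le_one ha u.toNNReal] with ω hω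
    rcases Nat.le_one_iff_eq_zero_or_eq_one.1 hω with h | h <;> simp [h, deathOperator]
  simp only [hg, mul_neg, intervalIntegral.integral_neg, h0, NNReal.coe_zero] at h
  simp only [Real.toNNReal_coe]
  linarith

/-- Almost all paths of the theta-positive process without offspring are nonincreasing. -/
theorem IsThetaPositiveProcess.ae_antitone (hZ : IsThetaPositiveProcess θ lam a P Z)
    (ha : ∀ t, 0 ≤ t → a t = 0) : ∀ᵐ ω ∂P, Antitone (fun t => Z t ω) := by
  let d := TopologicalSpace.denseSeq ℝ≥0
  have h1 : ∀ᵐ ω ∂P, ∀ n, Z (d n) ω ≤ 1 := ae_all_iff.2 fun n => hZ.ae_le_one ha _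
  have h2 : ∀ᵐ ω ∂P, ∀ n k, d n ≤ d k → Z (d n) ω = 0 → Z (d k) ω = 0 :=
    ae_all_iff.2 fun n => ae_all_iff.2 fun k => by
      by_cases h : d n ≤ d k
      · simpa [h] using hZ.ae_eq_zero_of_eq_zero ha h
      · simp [h]
  filter_upwards [h1, h2] with ω h1 h2
  -- Since `ℕ` is discrete, right-continuity keeps the path constant just after `s`, which transfers
  -- the comparison to countably many times.
  have hd : ∀ s t : ℝ≥0, s < t → ∃ n, s < d n ∧ d n < t ∧ Z (d n) ω = Z s ω := fun s t hst => by
    have hc := (hZ.isBranchingProcess.rightContinuous ω s).eventually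
      (isOpen_discrete {Z s ω} |>.mem_nhds rfl)
    obtain ⟨v, hv, hsub⟩ := (mem_nhdsGE_iff_exists_mem_Ioc_Ico_subset hst).1 hc
    obtain ⟨x, hx, n, rfl⟩ := (TopologicalSpace.denseRange_denseSeq ℝ≥0).inter_open_nonempty
      (Set.Ioo s v) isOpen_Ioo (Set.nonempty_Ioo.2 hv.1)
    exact ⟨n, hx.1, hx.2.trans_le hv.2, hsub ⟨hx.1.le, hx.2⟩⟩
  intro s t hst
  rcases hst.eq_or_lt with rfl | hst
  · exact le_rfl
  obtain ⟨n, hn, hnt, en⟩ := hd s t hst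
  obtain ⟨k, hk, -, ek⟩ := hd t (t + 1) (lt_add_of_pos_right _ one_pos)
  have hle := h1 k
  have := h2 n k (hnt.trans hk).le
  simp only [← en, ← ek]
  omega

end PureDeath

/-! ### Limits -/

theorem mainTheorem10 {Ω : Type*} [MeasurableSpace Ω] (P : Measure Ω) [IsProbabilityMeasure P]
    (θ : ℝ) (lam a : ℝ → ℝ) (Z : ℝ≥0 → Ω → ℕ)
    (hZ : IsThetaPositiveProcess θ lam a P Z)
    (L : ℝ) (hL : Tendsto (cumulativeHazard lam) atTop (𝓝 L))
    (ha : ∀ t, 0 ≤ t → a t = 0) :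
    IsAsymptoticallyDegenerate P Z ∧
    Tendsto (meanSize P Z) atTop (𝓝 (ENNReal.ofReal (Real.exp (-L)))) ∧
    ∃ Zinf : Ω → ℕ, Measurable Zinf ∧
      (∀ᵐ ω ∂P, Tendsto (fun t => Z t ω) atTop (𝓝 (Zinf ω))) ∧
      P.real {ω | Zinf ω = 1} = Real.exp (-L) ∧
      P.real {ω | Zinf ω = 0} = 1 - Real.exp (-L) ∧
      ∀ s : ℝ, 0 ≤ s → s ≤ 1 →
        ∫ ω, s ^ Zinf ω ∂P = 1 - Real.exp (-L) + Real.exp (-L) * s := by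
  have hm := hZ.isBranchingProcess.measurable
  have hbern : ∀ X : Ω → ℕ, Measurable X → (∀ᵐ ω ∂P, X ω ≤ 1) →
      P.real (X ⁻¹' {0}) = 1 - P.real (X ⁻¹' {1}) := fun X hX h1 => by
    rw [← probReal_compl_eq_one_sub (hX MeasurableSet.of_discrete)]
    refine measureReal_congr ?_
    filter_upwards [h1] with ω hω
    have : X ω = 0 ↔ ¬ X ω = 1 := by omega
    exact propext this
  have hlim : Tendsto (fun t => P.real (Z t ⁻¹' {1})) atTop (𝓝 (Real.exp (-L))) := by
    simp only [hZ.measureReal_eq_one ha]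
    exact (Real.continuous_exp.tendsto _).comp hL.neg
  have hmean : Tendsto (meanSize P Z) atTop (𝓝 (ENNReal.ofReal (Real.exp (-L)))) := by
    have : meanSize P Z = fun t => ENNReal.ofReal (P.real (Z t ⁻¹' {1})) := funext fun t => by
      rw [ofReal_measureReal, ← lintegral_indicator_one (hm t MeasurableSet.of_discrete)]
      refine lintegral_congr_ae ?_
      filter_upwards [hZ.ae_le_one ha t] with ω hω
      rcases Nat.le_one_iff_eq_zero_or_eq_one.1 hω with h | h <;> simp [h, Set.indicator]
    rw [this]
    exact ENNReal.tendsto_ofReal hlim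
  refine ⟨⟨⟨1 - Real.exp (-L), ?_, by linarith [Real.exp_pos (-L)]⟩, ?_⟩, hmean, ?_⟩
  · exact (hlim.const_sub 1).congr fun t => (hbern _ (hm t) (hZ.ae_le_one ha t)).symm
  · rw [hmean.liminf_eq]
    exact ENNReal.ofReal_lt_top
  -- Eternal survival; by monotonicity, integer times suffice, which makes the event measurable.
  let B : Set Ω := ⋂ n : ℕ, Z n ⁻¹' {1}
  have hB : MeasurableSet B := MeasurableSet.iInter fun n => hm n MeasurableSet.of_discrete
  have hXm : Measurable (B.indicator (1 : Ω → ℕ)) := measurable_one.indicator hB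
  have hX1 : ∀ ω, B.indicator (1 : Ω → ℕ) ω ≤ 1 := fun ω => Set.indicator_le_self' (by simp) ω
  have hconv : ∀ᵐ ω ∂P, Tendsto (fun t => Z t ω) atTop (𝓝 (B.indicator (1 : Ω → ℕ) ω)) := by
    filter_upwards [hZ.ae_antitone ha, hZ.isBranchingProcess.init] with ω hanti h0
    have hle : ∀ t, Z t ω ≤ 1 := fun t => h0 ▸ hanti (zero_le (a := t))
    by_cases hω : ω ∈ B
    · rw [Set.indicator_of_mem hω]
      refine tendsto_const_nhds.congr fun t => le_antisymm ?_ (hle t)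
      obtain ⟨n, hn⟩ := exists_nat_ge t
      have : Z n ω = 1 := Set.mem_iInter.1 hω n
      exact this.symm.le.trans (hanti hn)
    · rw [Set.indicator_of_notMem hω]
      simp only [B, Set.mem_iInter, Set.mem_preimage, Set.mem_singleton_iff, not_forall] at hω
      obtain ⟨n, hn⟩ := hω
      refine tendsto_const_nhds.congr' ?_
      filter_upwards [eventually_ge_atTop (n : ℝ≥0)] with t ht
      have := hanti ht
      have := hle n
      simp only at *
      omega
  have hone : P.real (B.indicator (1 : Ω → ℕ) ⁻¹' {1}) = Real.exp (-L) := by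
    refine tendsto_nhds_unique ?_ (hlim.comp tendsto_natCast_atTop_atTop)
    simp only [← integral_indicator_one_comp P hXm, Function.comp_def,
      ← integral_indicator_one_comp P (hm _)]
    refine tendsto_integral_of_dominated_convergence (fun _ => 1)
      (fun n => ((measurable_of_countable (({1} : Set ℕ).indicator (1 : ℕ → ℝ))).comp
        (hm n)).aestronglyMeasurable)
      (integrable_const 1) (fun n => ae_of_all _ fun ω => ?_) ?_
    · simp only [Set.indicator]
      split_ifs <;> simp
    · filter_upwards [hconv] with ω hω
      exact (continuous_of_discreteTopology.tendsto _).comp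
        (hω.comp tendsto_natCast_atTop_atTop)
  have hint : ∀ S : Set ℕ,
      Integrable (fun ω => S.indicator (1 : ℕ → ℝ) (B.indicator (1 : Ω → ℕ) ω)) P := fun S =>
    (integrable_const (1 : ℝ)).indicator (hXm (MeasurableSet.of_discrete (s := S)))
  have hzero := hbern _ hXm (ae_of_all _ hX1)
  rw [hone] at hzero
  refine ⟨B.indicator 1, hXm, hconv, hone, hzero, fun s _ _ => ?_⟩
  -- For `X` in `{0, 1}`, `s ^ X` is the indicator of `X = 0` plus `s` times that of `X = 1`, also
  -- at `s = 0` since `0 ^ 0 = 1`.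
  rw [← hzero, ← hone, ← integral_indicator_one_comp P hXm, ← integral_indicator_one_comp P hXm,
    ← integral_mul_const, ← integral_add (hint _) ((hint _).mul_const s)]
  refine integral_congr_ae (ae_of_all _ fun ω => ?_)
  rcases Nat.le_one_iff_eq_zero_or_eq_one.1 (hX1 ω) with h | h <;> simp only [h] <;> simp
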